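/- Let $(\Omega,\mu)$ be an arbitrary measure space. For $\mathbb K\in\{\mathbb R,\mathbb C\}$ let $\mathcal L^1+\mathcal L^\infty$ be the space of a.e. classes of $\mathbb K$-valued measurable functions on $\Omega$ of the form $g+h$ with $g\in\mathcal L^1$, $h\in\mathcal L^\infty$. For such $f$ put $\mu_t(f)=\inf\{\lambda>0:\ \mu\{|f|>\lambda\}\le t\}$ for $t>0$, and let $$\mathcal R_\mu=\{f\in\mathcal L^1+\mathcal L^\infty:\ \mu_t(f)\to 0\text{ as }t\to\infty\}.$$ A Dunford–Schwartz operator is a $\mathbb K$-linear map $T:\mathcal L^1+\mathcal L^\infty\to\mathcal L^1+\mathcal L^\infty$ with $\|Tf\|_1\le\|f\|_1$ for all $f\in\mathcal L^1$ and $\|Tf\|_\infty\le\|f\|_\infty$ for all $f\in\mathcal L^\infty$; it is positive if $Tf\ge 0$ whenever $f\ge 0$. Theorem. Suppose that either $\mathbb K=\mathbb R$ and $T$ is a Dunford–Schwartz operator, or $\mathbb K=\mathbb C$ and $T$ is a positive Dunford–Schwartz operator. Then for every $f\in\mathcal R_\mu$ the averages $$a_n(f)=\frac1n\sum_{k=0}^{n-1}T^k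 f$$ converge a.e. to some $\widehat f\in\mathcal R_\mu$. -/

import Mathlib

open Filter Topology MeasureTheory
open scoped NNReal ENNReal

/-- The space `L¹ + L^∞` inside the space `L⁰` of a.e. classes of measurable `𝕜`-valued functions
(the submodule sum of `L¹` and `L^∞`). -/
noncomputable def L1AddLinf {Ω : Type*} [MeasurableSpace Ω] (𝕜 : Type*) [RCLike 𝕜]
    (μ : Measure Ω) : Submodule 𝕜 (Ω →ₘ[μ] 𝕜) :=
  Lp.LpSubmodule 𝕜 𝕜 1 μ ⊔ Lp.LpSubmodule 𝕜 𝕜 ∞ μ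

/-- The non-increasing rearrangement `μ_t(f) = inf {lam > 0 : μ {|f| > lam} ≤ t}`, with values in
`[0, ∞]`, so that the infimum of the empty set is `∞`. -/
noncomputable def rearrangement {Ω : Type*} [MeasurableSpace Ω] {𝕜 : Type*} [RCLike 𝕜]
    (μ : Measure Ω) (f : Ω →ₘ[μ] 𝕜) (t : ℝ≥0) : ℝ≥0∞ :=
  sInf {lam : ℝ≥0∞ | 0 < lam ∧ μ {x | lam < ‖f x‖ₑ} ≤ (t : ℝ≥0∞)}

/-- `R_μ`: the functions in `L¹ + L^∞` whose non-increasing rearrangement tends to `0`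
at infinity. -/
def RMu {Ω : Type*} [MeasurableSpace Ω] (𝕜 : Type*) [RCLike 𝕜] (μ : Measure Ω) :
    Set (Ω →ₘ[μ] 𝕜) :=
  {f | f ∈ L1AddLinf 𝕜 μ ∧ Tendsto (fun t : ℝ≥0 => rearrangement μ f t) atTop (𝓝 0)}

/-- Dunford–Schwartz operators: linear operators on `L¹ + L^∞` that contract the `L¹`-norm on `L¹`
and the `L^∞`-norm on `L^∞`. -/
structure IsDunfordSchwartz {Ω : Type*} [MeasurableSpace Ω] {𝕜 : Type*} [RCLike 𝕜]
    {μ : Measure Ω} (T : Module.End 𝕜 (L1AddLinf 𝕜 μ)) : Prop where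
  one_le : ∀ f : L1AddLinf 𝕜 μ, (f : Ω →ₘ[μ] 𝕜) ∈ Lp 𝕜 1 μ →
    eLpNorm (T f : Ω →ₘ[μ] 𝕜) 1 μ ≤ eLpNorm (f : Ω →ₘ[μ] 𝕜) 1 μ
  top_le : ∀ f : L1AddLinf 𝕜 μ, (f : Ω →ₘ[μ] 𝕜) ∈ Lp 𝕜 ∞ μ →
    eLpNorm (T f : Ω →ₘ[μ] 𝕜) ∞ μ ≤ eLpNorm (f : Ω →ₘ[μ] 𝕜) ∞ μ

/-- A class of functions is nonnegative if a.e. its values are nonnegative real numbers. -/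
def IsNonnegClass {Ω : Type*} [MeasurableSpace Ω] {𝕜 : Type*} [RCLike 𝕜]
    {μ : Measure Ω} (f : Ω →ₘ[μ] 𝕜) : Prop :=
  ∀ᵐ x ∂μ, 0 ≤ RCLike.re (f x) ∧ RCLike.im (f x) = 0

/-- Positive operators on `L¹ + L^∞`: they map nonnegative functions to nonnegative functions. -/
def IsPositiveOperator {Ω : Type*} [MeasurableSpace Ω] {𝕜 : Type*} [RCLike 𝕜]
    {μ : Measure Ω} (T : Module.End 𝕜 (L1AddLinf 𝕜 μ)) : Prop :=
  ∀ f : L1AddLinf 𝕜 μ, IsNonnegClass (f : Ω →ₘ[μ] 𝕜) → IsNonnegClass (T f : Ω →ₘ[μ] 𝕜)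

/-- The ergodic averages `a_n(f) = (1/n) ∑_{k<n} T^k f`. -/
noncomputable def ergodicAverage {Ω : Type*} [MeasurableSpace Ω] {𝕜 : Type*} [RCLike 𝕜]
    {μ : Measure Ω} (T : Module.End 𝕜 (L1AddLinf 𝕜 μ)) (n : ℕ) (f : L1AddLinf 𝕜 μ) :
    L1AddLinf 𝕜 μ :=
  (n : 𝕜)⁻¹ • ∑ k ∈ Finset.range n, (T ^ k) f

/-- The averages `a_n(f)` converge a.e. to some function in `R_μ`. -/
def AveragesConvergeInRMu {Ω : Type*} [MeasurableSpace Ω] {𝕜 : Type*} [RCLike 𝕜]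
    {μ : Measure Ω} (T : Module.End 𝕜 (L1AddLinf 𝕜 μ)) (f : L1AddLinf 𝕜 μ) : Prop :=
  ∃ g ∈ RMu 𝕜 μ, ∀ᵐ x ∂μ,
    Tendsto (fun n : ℕ => (ergodicAverage T n f : Ω →ₘ[μ] 𝕜) x) atTop (𝓝 (g x))

/-! Everything is measured by the excess `(|f| - a)⁺` over a level `a > 0`: a class lies in R_μ
exactly when all these excesses are integrable (`mem_RMu_iff`). A Dunford–Schwartz operator does not
increase the integral of the excess: truncating `u` in modulus at `a`, the bounded part stays below
`a` and the rest is contracted in L¹.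

The main tool is a weak type maximal inequality. Chacon's filling scheme, run with truncations in
modulus, gives it on L¹ (`maximal_L1`); truncation extends it to L¹ + L^∞, with the excess on the
right (`maximal`).

Slicing `|u|²` into excesses shows that `T` contracts L². The Hilbert space splitting into fixed
vectors and closure of coboundaries then provides approximants with convergent averages, and the
maximal inequality carries convergence first to L² and then to R_μ, whose elements are L² functions
up to small excess. Fatou's lemma, applied to the excesses of the averages, puts the limit in R_μ.
-/

section

variable {Ω : Type*} [MeasurableSpace Ω] {𝕜 : Type*} [RCLike 𝕜] {μ : Measure Ω}

/-! ### Pointwise calculus and truncation in L¹ + L^∞ -/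

namespace L1AddLinf

theorem coeFn_add (u v : L1AddLinf 𝕜 μ) :
    ∀ᵐ x ∂μ, ((u + v : L1AddLinf 𝕜 μ) : Ω →ₘ[μ] 𝕜) x
      = (u : Ω →ₘ[μ] 𝕜) x + (v : Ω →ₘ[μ] 𝕜) x :=
  AEEqFun.coeFn_add (u : Ω →ₘ[μ] 𝕜) v

theorem coeFn_sub (u v : L1AddLinf 𝕜 μ) :
    ∀ᵐ x ∂μ, ((u - v : L1AddLinf 𝕜 μ) : Ω →ₘ[μ] 𝕜) x
      = (u : Ω →ₘ[μ] 𝕜) x - (v : Ω →ₘ[μ] 𝕜) x :=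
  AEEqFun.coeFn_sub (u : Ω →ₘ[μ] 𝕜) v

theorem coeFn_smul (c : 𝕜) (u : L1AddLinf 𝕜 μ) :
    ∀ᵐ x ∂μ, ((c • u : L1AddLinf 𝕜 μ) : Ω →ₘ[μ] 𝕜) x = c * (u : Ω →ₘ[μ] 𝕜) x :=
  AEEqFun.coeFn_smul c (u : Ω →ₘ[μ] 𝕜)

theorem coeFn_zero : ∀ᵐ x ∂μ, ((0 : L1AddLinf 𝕜 μ) : Ω →ₘ[μ] 𝕜) x = 0 :=
  AEEqFun.coeFn_zero

end L1AddLinf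

theorem mem_L1AddLinf_of_mem_L1 {u : Ω →ₘ[μ] 𝕜} (hu : u ∈ Lp 𝕜 1 μ) : u ∈ L1AddLinf 𝕜 μ :=
  (le_sup_left : Lp.LpSubmodule 𝕜 𝕜 1 μ ≤ L1AddLinf 𝕜 μ) hu

theorem mem_L1AddLinf_of_mem_Linf {u : Ω →ₘ[μ] 𝕜} (hu : u ∈ Lp 𝕜 ∞ μ) :
    u ∈ L1AddLinf 𝕜 μ :=
  (le_sup_right : Lp.LpSubmodule 𝕜 𝕜 ∞ μ ≤ L1AddLinf 𝕜 μ) hu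

theorem mem_Linf_of_ae_bound {u : Ω →ₘ[μ] 𝕜} {a : ℝ} (hu : ∀ᵐ x ∂μ, ‖u x‖ ≤ a) :
    u ∈ Lp 𝕜 ∞ μ := by
  rw [Lp.mem_Lp_iff_eLpNorm_lt_top, eLpNorm_exponent_top]
  exact eLpNormEssSup_lt_top_of_ae_bound hu

theorem mem_L1_iff {u : Ω →ₘ[μ] 𝕜} : u ∈ Lp 𝕜 1 μ ↔ ∫⁻ x, ‖u x‖ₑ ∂μ < ∞ := by
  rw [Lp.mem_Lp_iff_eLpNorm_lt_top, eLpNorm_one_eq_lintegral_enorm]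

theorem mem_L1_of_le {u v : Ω →ₘ[μ] 𝕜} (hv : v ∈ Lp 𝕜 1 μ) (h : ∀ᵐ x ∂μ, ‖u x‖ ≤ ‖v x‖) :
    u ∈ Lp 𝕜 1 μ := by
  rw [Lp.mem_Lp_iff_eLpNorm_lt_top] at *
  exact (eLpNorm_mono_ae h).trans_lt hv

/-- Every class of functions `u` can be truncated in modulus at a given nonnegative function. -/
theorem exists_truncation (u : Ω →ₘ[μ] 𝕜) {s : Ω → ℝ} (hs : AEStronglyMeasurable s μ)
    (hs0 : ∀ᵐ x ∂μ, 0 ≤ s x) :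
    ∃ d : Ω →ₘ[μ] 𝕜, ∀ᵐ x ∂μ, ‖d x‖ = min ‖u x‖ (s x) ∧
      ‖u x - d x‖ = ‖u x‖ - min ‖u x‖ (s x) := by
  have hm : AEStronglyMeasurable
      (fun x => ((min ‖u x‖ (s x) / ‖u x‖ : ℝ) : 𝕜) * u x) μ := by
    refine AEStronglyMeasurable.mul ?_ u.aestronglyMeasurable
    refine RCLike.continuous_ofReal.comp_aestronglyMeasurable ?_
    have h1 : AEMeasurable (fun x => ‖u x‖) μ := u.aestronglyMeasurable.norm.aemeasurable
    exact ((h1.min hs.aemeasurable).div h1).aestronglyMeasurable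
  refine ⟨AEEqFun.mk _ hm, ?_⟩
  filter_upwards [AEEqFun.coeFn_mk _ hm, hs0] with x hx h0
  rw [hx]
  rcases eq_or_ne (u x) 0 with h | h
  · simp [h, h0]
  have hp : 0 < ‖u x‖ := norm_pos_iff.2 h
  have hmin : 0 ≤ min ‖u x‖ (s x) := le_min hp.le h0
  constructor
  · rw [norm_mul, RCLike.norm_ofReal, abs_of_nonneg (by positivity)]
    field_simp
  · have : u x - ((min ‖u x‖ (s x) / ‖u x‖ : ℝ) : 𝕜) * u x
        = ((1 - min ‖u x‖ (s x) / ‖u x‖ : ℝ) : 𝕜) * u x := by push_cast; ring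
    have h1 : min ‖u x‖ (s x) / ‖u x‖ ≤ 1 := div_le_one_of_le₀ (min_le_left _ _) hp.le
    rw [this, norm_mul, RCLike.norm_ofReal, abs_of_nonneg (by linarith)]
    field_simp

namespace IsDunfordSchwartz

variable {T : Module.End 𝕜 (L1AddLinf 𝕜 μ)}

theorem ae_norm_le (hT : IsDunfordSchwartz T) {u : L1AddLinf 𝕜 μ} {a : ℝ} (ha : 0 ≤ a)
    (hu : ∀ᵐ x ∂μ, ‖(u : Ω →ₘ[μ] 𝕜) x‖ ≤ a) : ∀ᵐ x ∂μ, ‖(T u : Ω →ₘ[μ] 𝕜) x‖ ≤ a := by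
  have h1 := hT.top_le u (mem_Linf_of_ae_bound hu)
  have h2 : eLpNorm (u : Ω →ₘ[μ] 𝕜) ∞ μ ≤ ENNReal.ofReal a := by
    simpa using eLpNorm_le_of_ae_bound (p := ∞) hu
  have h3 := enorm_ae_le_eLpNormEssSup (T u : Ω →ₘ[μ] 𝕜) μ
  filter_upwards [h3] with x hx
  have : ‖(T u : Ω →ₘ[μ] 𝕜) x‖ₑ ≤ ENNReal.ofReal a :=
    hx.trans ((eLpNorm_exponent_top (μ := μ)).symm.le.trans (h1.trans h2))
  rwa [← ofReal_norm, ENNReal.ofReal_le_ofReal_iff ha] at this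

theorem lintegral_le (hT : IsDunfordSchwartz T) {u : L1AddLinf 𝕜 μ}
    (hu : (u : Ω →ₘ[μ] 𝕜) ∈ Lp 𝕜 1 μ) :
    ∫⁻ x, ‖(T u : Ω →ₘ[μ] 𝕜) x‖ₑ ∂μ ≤ ∫⁻ x, ‖(u : Ω →ₘ[μ] 𝕜) x‖ₑ ∂μ := by
  simpa only [eLpNorm_one_eq_lintegral_enorm] using hT.one_le u hu

theorem mem_L1 (hT : IsDunfordSchwartz T) {u : L1AddLinf 𝕜 μ}
    (hu : (u : Ω →ₘ[μ] 𝕜) ∈ Lp 𝕜 1 μ) : (T u : Ω →ₘ[μ] 𝕜) ∈ Lp 𝕜 1 μ :=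
  mem_L1_iff.2 ((hT.lintegral_le hu).trans_lt (mem_L1_iff.1 hu))

end IsDunfordSchwartz

/-! ### The filling scheme and the maximal inequality on L¹ -/

/-- The partial sums `∑_{k<n} T^k f`. -/
noncomputable def orbitSum (T : Module.End 𝕜 (L1AddLinf 𝕜 μ)) (n : ℕ) (f : L1AddLinf 𝕜 μ) :
    L1AddLinf 𝕜 μ :=
  ∑ k ∈ Finset.range n, (T ^ k) f

theorem orbitSum_zero (T : Module.End 𝕜 (L1AddLinf 𝕜 μ)) (f : L1AddLinf 𝕜 μ) :
    orbitSum T 0 f = 0 := by simp [orbitSum]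

theorem orbitSum_succ (T : Module.End 𝕜 (L1AddLinf 𝕜 μ)) (n : ℕ) (f : L1AddLinf 𝕜 μ) :
    orbitSum T (n + 1) f = f + T (orbitSum T n f) := by
  rw [orbitSum, Finset.sum_range_succ', orbitSum, map_sum, add_comm]
  simp [pow_succ']

/-- One step of the filling scheme: `w = d + (w - d)`, where `d` is the truncation of `w` at the
remaining capacity `s`. -/
theorem exists_filling_step (w : L1AddLinf 𝕜 μ) (s : Ω → ℝ) :
    ∃ d : L1AddLinf 𝕜 μ, (w : Ω →ₘ[μ] 𝕜) ∈ Lp 𝕜 1 μ → AEStronglyMeasurable s μ →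
      (∀ᵐ x ∂μ, 0 ≤ s x) → ∀ᵐ x ∂μ,
        ‖(d : Ω →ₘ[μ] 𝕜) x‖ = min ‖(w : Ω →ₘ[μ] 𝕜) x‖ (s x) ∧
        ‖((w - d : L1AddLinf 𝕜 μ) : Ω →ₘ[μ] 𝕜) x‖
          = ‖(w : Ω →ₘ[μ] 𝕜) x‖ - min ‖(w : Ω →ₘ[μ] 𝕜) x‖ (s x) := by
  by_cases h : (w : Ω →ₘ[μ] 𝕜) ∈ Lp 𝕜 1 μ ∧ AEStronglyMeasurable s μ ∧ ∀ᵐ x ∂μ, 0 ≤ s x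
  · obtain ⟨hw, hs, hs0⟩ := h
    obtain ⟨d, hd⟩ := exists_truncation (w : Ω →ₘ[μ] 𝕜) hs hs0
    have hd1 : d ∈ Lp 𝕜 1 μ :=
      mem_L1_of_le hw (hd.mono fun x hx => hx.1.le.trans (min_le_left _ _))
    refine ⟨⟨d, mem_L1AddLinf_of_mem_L1 hd1⟩, fun _ _ _ => ?_⟩
    filter_upwards [hd, L1AddLinf.coeFn_sub w ⟨d, mem_L1AddLinf_of_mem_L1 hd1⟩] with x hx h2
    rw [h2]
    exact hx
  -- A default value: the hypotheses sit behind the existential so that `choose` yields a total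
  -- function of `w` and `s`.
  · exact ⟨0, fun h1 h2 h3 => absurd ⟨h1, h2, h3⟩ h⟩

/-- The filling scheme of Chacon. -/
theorem IsDunfordSchwartz.exists_filling {T : Module.End 𝕜 (L1AddLinf 𝕜 μ)}
    (hT : IsDunfordSchwartz T) {f : L1AddLinf 𝕜 μ} (hf : (f : Ω →ₘ[μ] 𝕜) ∈ Lp 𝕜 1 μ)
    {a : ℝ} (ha : 0 < a) :
    ∃ (w d : ℕ → L1AddLinf 𝕜 μ) (s : ℕ → Ω → ℝ), w 0 = f ∧ (∀ k, w (k + 1) = T (w k - d k)) ∧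
      (∀ x, s 0 x = a) ∧
      (∀ k x, s (k + 1) x = s k x - ‖(d k : Ω →ₘ[μ] 𝕜) x‖) ∧
      (∀ k, AEStronglyMeasurable (s k) μ) ∧
      (∀ k, ∀ᵐ x ∂μ, 0 ≤ s k x) ∧
      (∀ k, ((w k - d k : L1AddLinf 𝕜 μ) : Ω →ₘ[μ] 𝕜) ∈ Lp 𝕜 1 μ) ∧
      ∀ k, ∀ᵐ x ∂μ, ‖(d k : Ω →ₘ[μ] 𝕜) x‖ = min ‖(w k : Ω →ₘ[μ] 𝕜) x‖ (s k x) ∧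
        ‖((w k - d k : L1AddLinf 𝕜 μ) : Ω →ₘ[μ] 𝕜) x‖
          = ‖(w k : Ω →ₘ[μ] 𝕜) x‖ - min ‖(w k : Ω →ₘ[μ] 𝕜) x‖ (s k x) := by
  choose D hD using fun (w : L1AddLinf 𝕜 μ) (s : Ω → ℝ) => exists_filling_step w s
  let st : ℕ → L1AddLinf 𝕜 μ × (Ω → ℝ) := fun n => Nat.rec (f, fun _ => a)
    (fun _ p => (T (p.1 - D p.1 p.2), fun x => p.2 x - ‖(D p.1 p.2 : Ω →ₘ[μ] 𝕜) x‖)) n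
  have key : ∀ k, ((st k).1 : Ω →ₘ[μ] 𝕜) ∈ Lp 𝕜 1 μ ∧ AEStronglyMeasurable (st k).2 μ ∧
      ∀ᵐ x ∂μ, 0 ≤ (st k).2 x := by
    intro k
    induction k with
    | zero => exact ⟨hf, aestronglyMeasurable_const, Eventually.of_forall fun _ => ha.le⟩
    | succ k ih =>
      obtain ⟨h1, h2, h3⟩ := ih
      have h4 := hD _ _ h1 h2 h3
      refine ⟨hT.mem_L1 (mem_L1_of_le h1 ?_),
        h2.sub (AEEqFun.aestronglyMeasurable _).norm, ?_⟩
      · filter_upwards [h4, h3] with x hx h0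
        rw [hx.2]
        have : 0 ≤ min ‖((st k).1 : Ω →ₘ[μ] 𝕜) x‖ ((st k).2 x) := le_min (norm_nonneg _) h0
        linarith
      · filter_upwards [h4] with x hx
        have : ‖(D (st k).1 (st k).2 : Ω →ₘ[μ] 𝕜) x‖ ≤ (st k).2 x :=
          hx.1.le.trans (min_le_right _ _)
        exact sub_nonneg.2 this
  refine ⟨fun k => (st k).1, fun k => D (st k).1 (st k).2, fun k => (st k).2, rfl, fun _ => rfl,
    fun _ => rfl, fun _ _ => rfl, fun k => (key k).2.1, fun k => (key k).2.2,
    fun k => ?_, fun k => hD _ _ (key k).1 (key k).2.1 (key k).2.2⟩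
  refine mem_L1_of_le (key k).1 ?_
  filter_upwards [hD _ _ (key k).1 (key k).2.1 (key k).2.2, (key k).2.2] with x hx h0
  rw [hx.2]
  have : 0 ≤ min ‖((st k).1 : Ω →ₘ[μ] 𝕜) x‖ ((st k).2 x) := le_min (norm_nonneg _) h0
  linarith

/-- The weak type `(1,1)` maximal inequality for Dunford–Schwartz operators. -/
theorem IsDunfordSchwartz.maximal_L1 {T : Module.End 𝕜 (L1AddLinf 𝕜 μ)}
    (hT : IsDunfordSchwartz T) {f : L1AddLinf 𝕜 μ} (hf : (f : Ω →ₘ[μ] 𝕜) ∈ Lp 𝕜 1 μ)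
    {a : ℝ} (ha : 0 < a) :
    ENNReal.ofReal a * μ {x | ∃ n : ℕ, n * a < ‖(orbitSum T n f : Ω →ₘ[μ] 𝕜) x‖}
      ≤ ∫⁻ x, ‖(f : Ω →ₘ[μ] 𝕜) x‖ₑ ∂μ := by
  obtain ⟨w, d, s, hw0, hw, hs0, hs, hsm, hsn, hwd, hd⟩ := hT.exists_filling hf ha
  -- `D` is what has been deposited, `F` collects the overflow still to be moved, and `C` is the
  -- part of the orbit sum generated by the deposits.
  let D : ℕ → L1AddLinf 𝕜 μ := fun m => ∑ i ∈ Finset.range m, d i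
  let F : ℕ → L1AddLinf 𝕜 μ := fun m => ∑ i ∈ Finset.range m, (w i - d i)
  let C : ℕ → L1AddLinf 𝕜 μ := fun n => Nat.rec 0 (fun k c => T c + D (k + 1)) n
  have hDs : ∀ m, D (m + 1) = D m + d m := fun m => Finset.sum_range_succ _ _
  have hFs : ∀ m, F (m + 1) = F m + (w m - d m) := fun m => Finset.sum_range_succ _ _
  have hCs : ∀ m, C (m + 1) = T (C m) + D (m + 1) := fun m => rfl
  -- Both sides equal `w 0 + ... + w n`.
  have hTF : ∀ n, f + T (F n) = F (n + 1) + D (n + 1) := by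
    intro n
    induction n with
    | zero =>
      simp only [F, D, Finset.sum_range_zero, Finset.sum_range_succ, map_zero, hw0, zero_add,
        add_zero]
      abel
    | succ n ih =>
      rw [hFs n, map_add, ← hw n, ← add_assoc, ih, hFs (n + 1), hDs (n + 1)]
      abel
  have hS : ∀ n, orbitSum T n f = F n + C n := by
    intro n
    induction n with
    | zero => simp [orbitSum_zero, F, C]
    | succ n ih =>
      rw [orbitSum_succ, ih, map_add, ← add_assoc, hTF, hCs]
      abel
  have hDb : ∀ m, ∀ᵐ x ∂μ, ‖(D m : Ω →ₘ[μ] 𝕜) x‖ ≤ a - s m x := by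
    intro m
    induction m with
    | zero =>
      filter_upwards [L1AddLinf.coeFn_zero (𝕜 := 𝕜) (μ := μ)] with x hx
      have h0 : D 0 = 0 := rfl
      rw [h0, hx, hs0]
      simp
    | succ m ih =>
      filter_upwards [ih, L1AddLinf.coeFn_add (D m) (d m)] with x hx h2
      rw [hDs, h2, hs]
      linarith [norm_add_le ((D m : Ω →ₘ[μ] 𝕜) x) ((d m : Ω →ₘ[μ] 𝕜) x)]
  have hCb : ∀ n : ℕ, ∀ᵐ x ∂μ, ‖(C n).1 x‖ ≤ n * a := by
    intro n
    induction n with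
    | zero =>
      filter_upwards [L1AddLinf.coeFn_zero (𝕜 := 𝕜) (μ := μ)] with x hx
      have h0 : C 0 = 0 := rfl
      rw [h0, hx]
      simp
    | succ n ih =>
      filter_upwards [hT.ae_norm_le (by positivity) ih, L1AddLinf.coeFn_add (T (C n)) (D (n + 1)),
        hDb (n + 1), hsn (n + 1)] with x h1 h2 h3 h4
      rw [hCs, h2]
      push_cast
      linarith [norm_add_le (((T (C n) : L1AddLinf 𝕜 μ) : Ω →ₘ[μ] 𝕜) x) ((D (n + 1) : Ω →ₘ[μ] 𝕜) x)]
  -- Overflow at a point means that the capacity there has been used up, and it never grows back.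
  have hF0 : ∀ n, ∀ᵐ x ∂μ, (F n : Ω →ₘ[μ] 𝕜) x ≠ 0 → s n x = 0 := by
    intro n
    induction n with
    | zero =>
      filter_upwards [L1AddLinf.coeFn_zero (𝕜 := 𝕜) (μ := μ)] with x hx h
      exact absurd hx h
    | succ n ih =>
      filter_upwards [ih, L1AddLinf.coeFn_add (F n) (w n - d n), hd n, hsn n, hsn (n + 1)]
        with x h1 h2 h3 h4 h5 h
      have h6 := hs n x
      by_cases hz : (F n : Ω →ₘ[μ] 𝕜) x = 0
      · rw [hFs, h2, hz, zero_add, ← norm_ne_zero_iff, h3.2] at h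
        rcases min_choice ‖(w n : Ω →ₘ[μ] 𝕜) x‖ (s n x) with hm | hm
        · rw [hm] at h
          simp at h
        · rw [h6, h3.1, hm, sub_self]
      · have := h1 hz
        have h7 := norm_nonneg ((d n : Ω →ₘ[μ] 𝕜) x)
        linarith
  -- Mass balance: filled capacity plus moving mass does not increase, as `T` contracts the L¹-norm.
  have hInt : ∀ n, ∫⁻ x, ENNReal.ofReal (a - s n x) ∂μ + ∫⁻ x, ‖(w n : Ω →ₘ[μ] 𝕜) x‖ₑ ∂μ
      ≤ ∫⁻ x, ‖(f : Ω →ₘ[μ] 𝕜) x‖ₑ ∂μ := by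
    intro n
    induction n with
    | zero => simp [hs0, hw0]
    | succ n ih =>
      refine le_trans ?_ ih
      have e1 : ∫⁻ x, ENNReal.ofReal (a - s (n + 1) x) ∂μ
          = ∫⁻ x, ENNReal.ofReal (a - s n x) ∂μ + ∫⁻ x, ‖(d n : Ω →ₘ[μ] 𝕜) x‖ₑ ∂μ := by
        rw [← lintegral_add_right' _ (AEEqFun.aestronglyMeasurable _).enorm]
        refine lintegral_congr_ae ?_
        filter_upwards [hDb n] with x hx
        have : 0 ≤ a - s n x := (norm_nonneg _).trans hx
        rw [hs, ← ofReal_norm, ← ENNReal.ofReal_add this (norm_nonneg _)]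
        congr 1
        ring
      have e2 : ∫⁻ x, ‖(w n : Ω →ₘ[μ] 𝕜) x‖ₑ ∂μ = ∫⁻ x, ‖(d n : Ω →ₘ[μ] 𝕜) x‖ₑ ∂μ
          + ∫⁻ x, ‖((w n - d n : L1AddLinf 𝕜 μ) : Ω →ₘ[μ] 𝕜) x‖ₑ ∂μ := by
        rw [← lintegral_add_right' _ (AEEqFun.aestronglyMeasurable _).enorm]
        refine lintegral_congr_ae ?_
        filter_upwards [hd n] with x hx
        rw [← ofReal_norm, ← ofReal_norm, ← ofReal_norm,
          ← ENNReal.ofReal_add (norm_nonneg _) (norm_nonneg _), hx.1, hx.2]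
        congr 1
        ring
      rw [e1, e2, hw, add_assoc]
      exact add_le_add le_rfl (add_le_add le_rfl (hT.lintegral_le (hwd n)))
  have hsub : ∀ N : ℕ, ENNReal.ofReal a *
      μ {x | ∃ n ≤ N, n * a < ‖(orbitSum T n f : Ω →ₘ[μ] 𝕜) x‖}
        ≤ ∫⁻ x, ‖(f : Ω →ₘ[μ] 𝕜) x‖ₑ ∂μ := by
    intro N
    have hanti : ∀ x, Antitone fun n => s n x := fun x =>
      antitone_nat_of_succ_le fun n => by
        rw [hs]
        linarith [norm_nonneg ((d n : Ω →ₘ[μ] 𝕜) x)]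
    have hle : μ {x | ∃ n ≤ N, n * a < ‖(orbitSum T n f : Ω →ₘ[μ] 𝕜) x‖}
        ≤ μ {x | ENNReal.ofReal a ≤ ENNReal.ofReal (a - s N x)} := by
      refine measure_mono_ae ?_
      filter_upwards [ae_all_iff.2 hF0, ae_all_iff.2 hCb,
        ae_all_iff.2 fun n => L1AddLinf.coeFn_add (F n) (C n), hsn N] with x h1 h2 h3 h4 h5
      obtain ⟨n, hn, h⟩ := h5
      -- `C n` alone is at most `n * a`, so a larger orbit sum needs overflow; the point is then
      -- filled up to `a`.
      have hne : (F n : Ω →ₘ[μ] 𝕜) x ≠ 0 := by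
        intro h0
        rw [hS, h3, h0, zero_add] at h
        exact absurd h (not_lt.2 (h2 n))
      have h6 : s N x ≤ s n x := hanti x hn
      rw [h1 n hne] at h6
      change ENNReal.ofReal a ≤ ENNReal.ofReal (a - s N x)
      exact ENNReal.ofReal_le_ofReal (by linarith)
    calc _ ≤ ENNReal.ofReal a * μ {x | ENNReal.ofReal a ≤ ENNReal.ofReal (a - s N x)} := by gcongr
      _ ≤ ∫⁻ x, ENNReal.ofReal (a - s N x) ∂μ :=
        mul_meas_ge_le_lintegral₀
          (aestronglyMeasurable_const.sub (hsm N)).aemeasurable.ennreal_ofReal _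
      _ ≤ _ := le_self_add.trans (hInt N)
  have hun : {x | ∃ n : ℕ, n * a < ‖(orbitSum T n f : Ω →ₘ[μ] 𝕜) x‖}
      = ⋃ N : ℕ, {x | ∃ n ≤ N, n * a < ‖(orbitSum T n f : Ω →ₘ[μ] 𝕜) x‖} := by
    ext x
    simp only [Set.mem_ofPred_eq, Set.mem_iUnion]
    exact ⟨fun ⟨n, hn⟩ => ⟨n, n, le_rfl, hn⟩, fun ⟨_, n, _, hn⟩ => ⟨n, hn⟩⟩
  have hmono : Monotone fun N : ℕ =>
      {x | ∃ n ≤ N, n * a < ‖(orbitSum T n f : Ω →ₘ[μ] 𝕜) x‖} :=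
    fun N M h x ⟨n, hn, hx⟩ => ⟨n, hn.trans h, hx⟩
  rw [hun, hmono.measure_iUnion, ENNReal.mul_iSup]
  exact iSup_le hsub

/-! ### Excess over a level -/

theorem lintegral_enorm_sq (u : Ω →ₘ[μ] 𝕜) :
    ∫⁻ x, ‖u x‖ₑ ^ 2 ∂μ = eLpNorm u 2 μ ^ 2 := by
  have h := eLpNorm_nnreal_pow_eq_lintegral (μ := μ) (f := u) (p := 2) two_ne_zero
  simpa using h.symm

theorem mem_L2_iff {u : Ω →ₘ[μ] 𝕜} : u ∈ Lp 𝕜 2 μ ↔ ∫⁻ x, ‖u x‖ₑ ^ 2 ∂μ < ∞ := by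
  rw [Lp.mem_Lp_iff_eLpNorm_lt_top, lintegral_enorm_sq, ENNReal.pow_lt_top_iff]
  simp

theorem ofReal_mul_ofReal_sub_le_sq {a r : ℝ} (ha : 0 ≤ a) (hr : 0 ≤ r) :
    ENNReal.ofReal a * ENNReal.ofReal (r - a) ≤ ENNReal.ofReal r ^ 2 := by
  rw [← ENNReal.ofReal_mul ha, ← ENNReal.ofReal_pow hr]
  exact ENNReal.ofReal_le_ofReal (by nlinarith [sq_nonneg (r - a)])

theorem lintegral_ofReal_norm_sub_le_sq (u : Ω →ₘ[μ] 𝕜) {a : ℝ} (ha : 0 ≤ a) :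
    ENNReal.ofReal a * ∫⁻ x, ENNReal.ofReal (‖u x‖ - a) ∂μ ≤ ∫⁻ x, ‖u x‖ₑ ^ 2 ∂μ := by
  rw [← lintegral_const_mul' _ _ ENNReal.ofReal_ne_top]
  refine lintegral_mono fun x => ?_
  rw [← ofReal_norm]
  exact ofReal_mul_ofReal_sub_le_sq ha (norm_nonneg _)

theorem exists_truncation_const (u : Ω →ₘ[μ] 𝕜) {a : ℝ} (ha : 0 ≤ a) :
    ∃ q : Ω →ₘ[μ] 𝕜, (∀ᵐ x ∂μ, ‖q x‖ ≤ a) ∧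
      (∀ᵐ x ∂μ, ‖q x‖ ≤ ‖u x‖) ∧
      ∀ᵐ x ∂μ, ‖(u - q : Ω →ₘ[μ] 𝕜) x‖ₑ = ENNReal.ofReal (‖u x‖ - a) := by
  obtain ⟨q, hq⟩ := exists_truncation u (s := fun _ => a) aestronglyMeasurable_const
    (Eventually.of_forall fun _ => ha)
  refine ⟨q, hq.mono fun x hx => hx.1.le.trans (min_le_right _ _),
    hq.mono fun x hx => hx.1.le.trans (min_le_left _ _), ?_⟩
  filter_upwards [hq, AEEqFun.coeFn_sub u q] with x hx h2
  rw [h2, Pi.sub_apply, ← ofReal_norm, hx.2]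
  rcases le_total ‖u x‖ a with h | h
  · rw [min_eq_left h, sub_self, ENNReal.ofReal_zero, ENNReal.ofReal_of_nonpos (by linarith)]
  · rw [min_eq_right h]

theorem mem_L1AddLinf_of_mem_L2 {u : Ω →ₘ[μ] 𝕜} (hu : u ∈ Lp 𝕜 2 μ) : u ∈ L1AddLinf 𝕜 μ := by
  obtain ⟨q, hq, -, hd⟩ := exists_truncation_const u zero_le_one
  rw [← sub_add_cancel u q]
  refine add_mem (mem_L1AddLinf_of_mem_L1 (mem_L1_iff.2 ?_))
    (mem_L1AddLinf_of_mem_Linf (mem_Linf_of_ae_bound hq))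
  rw [lintegral_congr_ae hd]
  have := lintegral_ofReal_norm_sub_le_sq u zero_le_one
  rw [ENNReal.ofReal_one, one_mul] at this
  exact this.trans_lt (mem_L2_iff.1 hu)

theorem L1AddLinf.exists_truncation_const (u : L1AddLinf 𝕜 μ) {a : ℝ} (ha : 0 ≤ a) :
    ∃ q : L1AddLinf 𝕜 μ, (∀ᵐ x ∂μ, ‖(q : Ω →ₘ[μ] 𝕜) x‖ ≤ a) ∧
      (∀ᵐ x ∂μ, ‖(q : Ω →ₘ[μ] 𝕜) x‖ ≤ ‖(u : Ω →ₘ[μ] 𝕜) x‖) ∧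
      ∀ᵐ x ∂μ, ‖((u - q : L1AddLinf 𝕜 μ) : Ω →ₘ[μ] 𝕜) x‖ₑ
        = ENNReal.ofReal (‖(u : Ω →ₘ[μ] 𝕜) x‖ - a) := by
  obtain ⟨q, hq, h⟩ := _root_.exists_truncation_const (u : Ω →ₘ[μ] 𝕜) ha
  exact ⟨⟨q, mem_L1AddLinf_of_mem_Linf (mem_Linf_of_ae_bound hq)⟩, hq, h⟩

theorem L1AddLinf.map_sub (S : Module.End 𝕜 (L1AddLinf 𝕜 μ)) (f g : L1AddLinf 𝕜 μ) :
    S (f - g) = S f - S g :=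
  _root_.map_sub S f g

theorem orbitSum_sub (T : Module.End 𝕜 (L1AddLinf 𝕜 μ)) (n : ℕ) (f g : L1AddLinf 𝕜 μ) :
    orbitSum T n (f - g) = orbitSum T n f - orbitSum T n g := by
  induction n with
  | zero =>
    rw [orbitSum_zero, orbitSum_zero, orbitSum_zero]
    abel
  | succ n ih =>
    rw [orbitSum_succ, orbitSum_succ, orbitSum_succ, ih, L1AddLinf.map_sub]
    abel

namespace IsDunfordSchwartz

variable {T : Module.End 𝕜 (L1AddLinf 𝕜 μ)}

theorem orbitSum_ae_norm_le (hT : IsDunfordSchwartz T) {u : L1AddLinf 𝕜 μ} {a : ℝ} (ha : 0 ≤ a)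
    (hu : ∀ᵐ x ∂μ, ‖(u : Ω →ₘ[μ] 𝕜) x‖ ≤ a) (n : ℕ) :
    ∀ᵐ x ∂μ, ‖(orbitSum T n u).1 x‖ ≤ n * a := by
  induction n with
  | zero =>
    filter_upwards [L1AddLinf.coeFn_zero (𝕜 := 𝕜) (μ := μ)] with x hx
    rw [orbitSum_zero, hx]
    simp
  | succ n ih =>
    filter_upwards [hT.ae_norm_le (by positivity) ih,
      L1AddLinf.coeFn_add u (T (orbitSum T n u)), hu] with x h1 h2 h3
    rw [orbitSum_succ, h2]
    push_cast
    linarith [norm_add_le (u.1 x) ((T (orbitSum T n u)).1 x)]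

/-- With `q` the truncation of `u` at `a`, `|T q| ≤ a` gives `|T u| - a ≤ |T (u - q)|`, and `|u -
q|` is the excess of `u`. -/
theorem lintegral_ofReal_norm_sub_le (hT : IsDunfordSchwartz T) (u : L1AddLinf 𝕜 μ) {a : ℝ}
    (ha : 0 ≤ a) :
    ∫⁻ x, ENNReal.ofReal (‖(T u : Ω →ₘ[μ] 𝕜) x‖ - a) ∂μ
      ≤ ∫⁻ x, ENNReal.ofReal (‖(u : Ω →ₘ[μ] 𝕜) x‖ - a) ∂μ := by
  obtain ⟨q, hq, -, hd⟩ := L1AddLinf.exists_truncation_const u ha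
  rw [← lintegral_congr_ae hd]
  rcases eq_or_ne (∫⁻ x, ‖((u - q : L1AddLinf 𝕜 μ) : Ω →ₘ[μ] 𝕜) x‖ₑ ∂μ) ∞ with h | h
  · rw [h]
    exact le_top
  refine le_trans ?_ (hT.lintegral_le (mem_L1_iff.2 h.lt_top))
  refine lintegral_mono_ae ?_
  filter_upwards [hT.ae_norm_le ha hq, L1AddLinf.coeFn_sub (T u) (T q)] with x h1 h2
  rw [L1AddLinf.map_sub, h2, ← ofReal_norm]
  refine ENNReal.ofReal_le_ofReal ?_
  linarith [norm_sub_norm_le ((T u).1 x) ((T q).1 x)]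

/-- The level is doubled because the truncation at `a` contributes at most `n * a` to the orbit sum;
`maximal_L1` handles the excess. -/
theorem maximal (hT : IsDunfordSchwartz T) (u : L1AddLinf 𝕜 μ) {a : ℝ} (ha : 0 < a) :
    ENNReal.ofReal a * μ {x | ∃ n : ℕ, n * (2 * a) < ‖(orbitSum T n u : Ω →ₘ[μ] 𝕜) x‖}
      ≤ ∫⁻ x, ENNReal.ofReal (‖(u : Ω →ₘ[μ] 𝕜) x‖ - a) ∂μ := by
  obtain ⟨q, hq, -, hd⟩ := L1AddLinf.exists_truncation_const u ha.le
  rw [← lintegral_congr_ae hd]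
  rcases eq_or_ne (∫⁻ x, ‖((u - q : L1AddLinf 𝕜 μ) : Ω →ₘ[μ] 𝕜) x‖ₑ ∂μ) ∞ with h | h
  · rw [h]
    exact le_top
  refine le_trans ?_ (hT.maximal_L1 (mem_L1_iff.2 h.lt_top) ha)
  refine mul_le_mul_right (measure_mono_ae ?_) _
  filter_upwards [ae_all_iff.2 (hT.orbitSum_ae_norm_le ha.le hq),
    ae_all_iff.2 fun n => L1AddLinf.coeFn_sub (orbitSum T n u) (orbitSum T n q)]
    with x h1 h2 ⟨n, hn⟩
  refine ⟨n, ?_⟩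
  rw [orbitSum_sub, h2]
  linarith [norm_sub_norm_le ((orbitSum T n u).1 x) ((orbitSum T n q).1 x), h1 n]

end IsDunfordSchwartz

/-! ### Contraction of the L²-norm -/

/-- A lower Riemann sum for `2 ∫ (s - t)⁺ dt` over `[0, K h]`, compared slice by slice. -/
theorem two_mul_sum_max_le_sq {h : ℝ} (hh : 0 ≤ h) (s : ℝ) (K : ℕ) :
    2 * h * ∑ k ∈ Finset.range K, max (s - (k + 1) * h) 0
      ≤ max s 0 ^ 2 - max (s - K * h) 0 ^ 2 := by
  induction K with
  | zero => simp
  | succ K ih =>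
    rw [Finset.sum_range_succ, mul_add]
    have : 2 * h * max (s - (K + 1) * h) 0
        ≤ max (s - K * h) 0 ^ 2 - max (s - (K + 1) * h) 0 ^ 2 := by
      obtain ⟨t, ht⟩ : ∃ t, t = s - K * h := ⟨_, rfl⟩
      have e : s - (K + 1) * h = t - h := by rw [ht]; ring
      rw [← ht, e]
      rcases le_total (t - h) 0 with h1 | h1
      · rw [max_eq_right h1]
        nlinarith [sq_nonneg (max t 0)]
      · rw [max_eq_left h1, max_eq_left (by linarith : 0 ≤ t)]
        nlinarith [sq_nonneg h]
    push_cast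
    linarith

/-- The same sum is an upper Riemann sum over `[h, (K + 1) h]`. -/
theorem sub_sq_le_two_mul_sum_max {h : ℝ} (hh : 0 ≤ h) (s : ℝ) (K : ℕ) :
    max (s - h) 0 ^ 2 - max (s - (K + 1) * h) 0 ^ 2
      ≤ 2 * h * ∑ k ∈ Finset.range K, max (s - (k + 1) * h) 0 := by
  induction K with
  | zero => simp
  | succ K ih =>
    rw [Finset.sum_range_succ, mul_add]
    have : max (s - (K + 1) * h) 0 ^ 2 - max (s - (K + 1 + 1) * h) 0 ^ 2
        ≤ 2 * h * max (s - (K + 1) * h) 0 := by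
      obtain ⟨t, ht⟩ : ∃ t, t = s - (K + 1) * h := ⟨_, rfl⟩
      have e : s - (K + 1 + 1) * h = t - h := by rw [ht]; ring
      rw [← ht, e]
      rcases le_total t 0 with h1 | h1
      · rw [max_eq_right h1]
        nlinarith [sq_nonneg (max (t - h) 0)]
      · rw [max_eq_left h1]
        rcases le_total (t - h) 0 with h2 | h2
        · rw [max_eq_right h2]
          nlinarith
        · rw [max_eq_left h2]
          nlinarith [sq_nonneg h]
    push_cast
    linarith

/-- Dunford–Schwartz operators contract the `L²`-norm. -/
theorem IsDunfordSchwartz.lintegral_sq_le {T : Module.End 𝕜 (L1AddLinf 𝕜 μ)}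
    (hT : IsDunfordSchwartz T) (u : L1AddLinf 𝕜 μ) :
    ∫⁻ x, ‖(T u : Ω →ₘ[μ] 𝕜) x‖ₑ ^ 2 ∂μ ≤ ∫⁻ x, ‖(u : Ω →ₘ[μ] 𝕜) x‖ₑ ^ 2 ∂μ := by
  have hmeas : ∀ v : Ω →ₘ[μ] 𝕜, AEMeasurable (fun x => ‖v x‖) μ := fun v =>
    v.aestronglyMeasurable.norm.aemeasurable
  have hsum : ∀ (v : Ω →ₘ[μ] 𝕜) (h : ℝ) (K : ℕ), 0 ≤ h →
      ∫⁻ x, ENNReal.ofReal (2 * h * ∑ k ∈ Finset.range K, max (‖v x‖ - (k + 1) * h) 0) ∂μ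
        = ENNReal.ofReal (2 * h) *
          ∑ k ∈ Finset.range K, ∫⁻ x, ENNReal.ofReal (‖v x‖ - (k + 1) * h) ∂μ := by
    intro v h K hh
    rw [← lintegral_finsetSum' _ fun k _ => ((hmeas v).sub_const _).ennreal_ofReal,
      ← lintegral_const_mul' _ _ ENNReal.ofReal_ne_top]
    refine lintegral_congr fun x => ?_
    rw [ENNReal.ofReal_mul (by positivity),
      ENNReal.ofReal_sum_of_nonneg fun _ _ => le_max_right _ _]
    simp
  -- With mesh `1 / (n + 1)` and `(n + 1) ^ 2` slices, the mesh tends to `0` while the slices reach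
  -- beyond height `n`, so `G n` tends to `|T u|²`.
  let h : ℕ → ℝ := fun n => 1 / ((n : ℝ) + 1)
  have hh : ∀ n, 0 ≤ h n := fun n => by positivity
  let G : ℕ → Ω → ℝ≥0∞ := fun n x => ENNReal.ofReal
    (max (‖(T u : Ω →ₘ[μ] 𝕜) x‖ - h n) 0 ^ 2
      - max (‖(T u : Ω →ₘ[μ] 𝕜) x‖ - (((n + 1) ^ 2 : ℕ) + 1) * h n) 0 ^ 2)
  have hGm : ∀ n, AEMeasurable (G n) μ := fun n =>
    (((((hmeas _).sub_const _).max aemeasurable_const).pow_const 2).sub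
      ((((hmeas _).sub_const _).max aemeasurable_const).pow_const 2)).ennreal_ofReal
  have hGle : ∀ n, ∫⁻ x, G n x ∂μ ≤ ∫⁻ x, ‖(u : Ω →ₘ[μ] 𝕜) x‖ₑ ^ 2 ∂μ := by
    intro n
    calc ∫⁻ x, G n x ∂μ
        ≤ ∫⁻ x, ENNReal.ofReal (2 * h n * ∑ k ∈ Finset.range ((n + 1) ^ 2),
            max (‖(T u : Ω →ₘ[μ] 𝕜) x‖ - (k + 1) * h n) 0) ∂μ :=
          lintegral_mono fun x =>
            ENNReal.ofReal_le_ofReal (sub_sq_le_two_mul_sum_max (hh n) _ _)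
      _ ≤ ∫⁻ x, ENNReal.ofReal (2 * h n * ∑ k ∈ Finset.range ((n + 1) ^ 2),
            max (‖(u : Ω →ₘ[μ] 𝕜) x‖ - (k + 1) * h n) 0) ∂μ := by
          rw [hsum _ _ _ (hh n), hsum _ _ _ (hh n)]
          refine mul_le_mul_right (Finset.sum_le_sum fun k _ => ?_) _
          exact hT.lintegral_ofReal_norm_sub_le u (mul_nonneg (by positivity) (hh n))
      _ ≤ _ := by
          refine lintegral_mono fun x => ?_
          rw [← ofReal_norm, ← ENNReal.ofReal_pow (norm_nonneg _)]
          refine ENNReal.ofReal_le_ofReal ((two_mul_sum_max_le_sq (hh n) _ _).trans ?_)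
          rw [max_eq_left (norm_nonneg _)]
          exact sub_le_self _ (sq_nonneg _)
  have hlim : ∀ x, Tendsto (fun n => G n x) atTop (𝓝 (‖(T u : Ω →ₘ[μ] 𝕜) x‖ₑ ^ 2)) := by
    intro x
    rw [← ofReal_norm, ← ENNReal.ofReal_pow (norm_nonneg _)]
    refine (ENNReal.continuous_ofReal.tendsto _).comp ?_
    obtain ⟨s, hs⟩ : ∃ s, s = ‖(T u : Ω →ₘ[μ] 𝕜) x‖ := ⟨_, rfl⟩
    have hs0 : 0 ≤ s := hs ▸ norm_nonneg _
    rw [← hs]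
    have h1 : Tendsto (fun n => max (s - h n) 0 ^ 2) atTop (𝓝 (s ^ 2)) := by
      have := (((tendsto_const_nhds (x := s)).sub
        (tendsto_one_div_add_atTop_nhds_zero_nat (𝕜 := ℝ))).max
        (tendsto_const_nhds (x := (0 : ℝ)))).pow 2
      simpa [hs0, h] using this
    refine h1.congr' ?_
    obtain ⟨N, hN⟩ := exists_nat_ge s
    filter_upwards [eventually_ge_atTop N] with n hn
    have h2 : s - (((n + 1) ^ 2 : ℕ) + 1) * h n ≤ 0 := by
      have h3 : (((n + 1) ^ 2 : ℕ) + 1 : ℝ) * h n = (n + 1) + h n := by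
        simp only [h]
        push_cast
        field_simp
      have h4 : (N : ℝ) ≤ n := by exact_mod_cast hn
      have h5 := hh n
      rw [h3]
      linarith
    simp only [max_eq_right h2]
    ring
  calc ∫⁻ x, ‖(T u : Ω →ₘ[μ] 𝕜) x‖ₑ ^ 2 ∂μ
      = ∫⁻ x, liminf (fun n => G n x) atTop ∂μ :=
        lintegral_congr fun x => (hlim x).liminf_eq.symm
    _ ≤ liminf (fun n => ∫⁻ x, G n x ∂μ) atTop := lintegral_liminf_le' hGm
    _ ≤ _ := liminf_le_of_frequently_le' (Frequently.of_forall hGle)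

/-! ### Fixed vectors, coboundaries and the splitting of L² -/

theorem orbitSum_add (T : Module.End 𝕜 (L1AddLinf 𝕜 μ)) (n : ℕ) (f g : L1AddLinf 𝕜 μ) :
    orbitSum T n (f + g) = orbitSum T n f + orbitSum T n g := by
  induction n with
  | zero =>
    rw [orbitSum_zero, orbitSum_zero, orbitSum_zero]
    abel
  | succ n ih =>
    rw [orbitSum_succ, orbitSum_succ, orbitSum_succ, ih, map_add]
    abel

theorem coeFn_ergodicAverage (T : Module.End 𝕜 (L1AddLinf 𝕜 μ)) (n : ℕ) (f : L1AddLinf 𝕜 μ) :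
    ∀ᵐ x ∂μ, (ergodicAverage T n f).1 x = (n : 𝕜)⁻¹ * (orbitSum T n f).1 x :=
  L1AddLinf.coeFn_smul _ _

/-- The averages of `f` converge a.e. -/
def AveragesConverge (T : Module.End 𝕜 (L1AddLinf 𝕜 μ)) (f : L1AddLinf 𝕜 μ) : Prop :=
  ∀ᵐ x ∂μ, ∃ l : 𝕜, Tendsto (fun n : ℕ => (n : 𝕜)⁻¹ * (orbitSum T n f).1 x) atTop (𝓝 l)

theorem AveragesConverge.add {T : Module.End 𝕜 (L1AddLinf 𝕜 μ)} {f g : L1AddLinf 𝕜 μ}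
    (hf : AveragesConverge T f) (hg : AveragesConverge T g) : AveragesConverge T (f + g) := by
  filter_upwards [hf, hg,
    ae_all_iff.2 fun n => L1AddLinf.coeFn_add (orbitSum T n f) (orbitSum T n g)]
    with x ⟨l, hl⟩ ⟨m, hm⟩ h
  refine ⟨l + m, (hl.add hm).congr fun n => ?_⟩
  rw [orbitSum_add, h, mul_add]

theorem averagesConverge_of_fixed {T : Module.End 𝕜 (L1AddLinf 𝕜 μ)} {p : L1AddLinf 𝕜 μ}
    (hp : T p = p) : AveragesConverge T p := by
  have hS : ∀ n : ℕ, orbitSum T n p = (n : 𝕜) • p := by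
    intro n
    induction n with
    | zero => rw [orbitSum_zero, Nat.cast_zero, zero_smul]
    | succ n ih =>
      rw [orbitSum_succ, ih, map_smul, hp, Nat.cast_succ, add_smul, one_smul, add_comm]
  filter_upwards [ae_all_iff.2 fun n : ℕ => L1AddLinf.coeFn_smul (n : 𝕜) p] with x hx
  refine ⟨p.1 x, tendsto_const_nhds.congr' ?_⟩
  filter_upwards [eventually_ne_atTop 0] with n hn
  rw [hS, hx, inv_mul_cancel_left₀ (Nat.cast_ne_zero.2 hn)]

theorem IsDunfordSchwartz.lintegral_sq_pow_le {T : Module.End 𝕜 (L1AddLinf 𝕜 μ)}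
    (hT : IsDunfordSchwartz T) (u : L1AddLinf 𝕜 μ) (n : ℕ) :
    ∫⁻ x, ‖((T ^ n) u).1 x‖ₑ ^ 2 ∂μ ≤ ∫⁻ x, ‖u.1 x‖ₑ ^ 2 ∂μ := by
  induction n with
  | zero => simp
  | succ n ih =>
    rw [pow_succ']
    exact (hT.lintegral_sq_le _).trans ih

/-- The series of `|T^n g|² / n²` has finite integral, hence converges a.e., and its terms tend to
`0`. -/
theorem IsDunfordSchwartz.ae_tendsto_inv_mul_pow {T : Module.End 𝕜 (L1AddLinf 𝕜 μ)}
    (hT : IsDunfordSchwartz T) {g : L1AddLinf 𝕜 μ} (hg : g.1 ∈ Lp 𝕜 2 μ) :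
    ∀ᵐ x ∂μ, Tendsto (fun n : ℕ => (n : 𝕜)⁻¹ * ((T ^ n) g).1 x) atTop (𝓝 0) := by
  let c : ℕ → ℝ≥0∞ := fun n => ENNReal.ofReal (1 / (n : ℝ) ^ 2)
  have hc : ∑' n, c n ≠ ∞ :=
    (Real.summable_one_div_nat_pow.2 one_lt_two).tsum_ofReal_ne_top
  have hm : ∀ n, AEMeasurable (fun x => c n * ‖((T ^ n) g).1 x‖ₑ ^ 2) μ := fun n =>
    ((AEEqFun.aestronglyMeasurable _).enorm.pow_const 2).const_mul _
  have hfin : ∫⁻ x, ∑' n, c n * ‖((T ^ n) g).1 x‖ₑ ^ 2 ∂μ ≠ ∞ := by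
    rw [lintegral_tsum hm]
    have hle : ∑' n, ∫⁻ x, c n * ‖((T ^ n) g).1 x‖ₑ ^ 2 ∂μ
        ≤ ∑' n, c n * ∫⁻ x, ‖g.1 x‖ₑ ^ 2 ∂μ := by
      refine ENNReal.tsum_le_tsum fun n => ?_
      rw [lintegral_const_mul' _ _ ENNReal.ofReal_ne_top]
      exact mul_le_mul_right (hT.lintegral_sq_pow_le g n) _
    rw [ENNReal.tsum_mul_right] at hle
    exact ne_top_of_le_ne_top (ENNReal.mul_ne_top hc (mem_L2_iff.1 hg).ne) hle
  filter_upwards [ae_lt_top' (AEMeasurable.tsum hm) hfin] with x hx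
  have h1 := ENNReal.tendsto_atTop_zero_of_tsum_ne_top hx.ne
  have h2 := (ENNReal.tendsto_toReal ENNReal.zero_ne_top).comp h1
  have h3 := (Real.continuous_sqrt.tendsto _).comp h2
  rw [ENNReal.toReal_zero, Real.sqrt_zero] at h3
  rw [tendsto_zero_iff_norm_tendsto_zero]
  refine h3.congr fun n => ?_
  have h4 : c n * ‖((T ^ n) g).1 x‖ₑ ^ 2
      = ENNReal.ofReal (‖(n : 𝕜)⁻¹ * ((T ^ n) g).1 x‖ ^ 2) := by
    rw [← ofReal_norm, ← ENNReal.ofReal_pow (norm_nonneg _),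
      ← ENNReal.ofReal_mul (by positivity)]
    congr 1
    rw [norm_mul, norm_inv, RCLike.norm_natCast, mul_pow, inv_pow, one_div]
  simp only [Function.comp_apply]
  rw [h4, ENNReal.toReal_ofReal (by positivity), Real.sqrt_sq (norm_nonneg _)]

theorem orbitSum_sub_map (T : Module.End 𝕜 (L1AddLinf 𝕜 μ)) (n : ℕ) (g : L1AddLinf 𝕜 μ) :
    orbitSum T n (g - T g) = g - (T ^ n) g := by
  induction n with
  | zero =>
    rw [orbitSum_zero, pow_zero, Module.End.one_apply]
    abel
  | succ n ih =>
    rw [orbitSum_succ, ih, L1AddLinf.map_sub, pow_succ', Module.End.mul_apply]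
    abel

theorem IsDunfordSchwartz.averagesConverge_coboundary {T : Module.End 𝕜 (L1AddLinf 𝕜 μ)}
    (hT : IsDunfordSchwartz T) {g : L1AddLinf 𝕜 μ} (hg : g.1 ∈ Lp 𝕜 2 μ) :
    AveragesConverge T (g - T g) := by
  filter_upwards [hT.ae_tendsto_inv_mul_pow hg,
    ae_all_iff.2 fun n : ℕ => L1AddLinf.coeFn_sub g ((T ^ n) g)] with x hx h
  refine ⟨0, ?_⟩
  have h1 : Tendsto (fun n : ℕ => (n : 𝕜)⁻¹ * g.1 x) atTop (𝓝 0) := by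
    simpa using (tendsto_inv_atTop_nhds_zero_nat (𝕜 := 𝕜)).mul_const (g.1 x)
  have h2 := h1.sub hx
  rw [sub_zero] at h2
  refine h2.congr fun n => ?_
  rw [orbitSum_sub_map, h, mul_sub]

/-- The range of `f - 1` is dense in the orthogonal complement of the fixed vectors of a
contraction `f` of a Hilbert space. -/
theorem exists_fixed_add_coboundary {E : Type*} [NormedAddCommGroup E] [InnerProductSpace 𝕜 E]
    [CompleteSpace E] (f : E →L[𝕜] E) (hf : ‖f‖ ≤ 1) (x : E) {ε : ℝ} (hε : 0 < ε) :
    ∃ p g : E, f p = p ∧ ‖x - (p + (g - f g))‖ < ε := by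
  let R : Submodule 𝕜 E := LinearMap.range ((f : E →ₗ[𝕜] E) - 1)
  have hR : ∀ y ∈ Rᗮ, f y = y := by
    -- Orthogonality to the range gives `⟨f y, y⟩ = ‖y‖²`; with `‖f y‖ ≤ ‖y‖` this is the equality
    -- case of Cauchy–Schwarz.
    intro y hy
    refine eq_of_norm_le_re_inner_eq_norm_sq (𝕜 := 𝕜) ?_ ?_
    · simpa using f.le_of_opNorm_le hf y
    · have : ∀ z, inner 𝕜 (f z) y = inner 𝕜 z y := by
        simpa [R, Submodule.mem_orthogonal, inner_sub_left, sub_eq_zero] using hy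
      simp [this]
  let K := R.topologicalClosure
  have : CompleteSpace K := (Submodule.isClosed_topologicalClosure R).completeSpace_coe
  obtain ⟨k, hk, p, hp, hx⟩ := K.exists_add_mem_mem_orthogonal x
  have hp' : f p = p := hR p (Submodule.orthogonal_le R.le_topologicalClosure hp)
  have hk' : k ∈ closure (R : Set E) := hk
  obtain ⟨_, ⟨g, rfl⟩, hd⟩ := Metric.mem_closure_iff.1 hk' ε hε
  -- The sign turns `f - 1` into `1 - f`.
  refine ⟨p, -g, hp', ?_⟩
  rw [dist_eq_norm] at hd
  have e : x - (p + (-g - f (-g))) = k - ((f : E →ₗ[𝕜] E) - 1) g := by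
    rw [hx, map_neg]
    simp only [LinearMap.sub_apply, ContinuousLinearMap.coe_coe, Module.End.one_apply]
    abel
  rwa [e]

theorem IsDunfordSchwartz.exists_L2_decomposition {T : Module.End 𝕜 (L1AddLinf 𝕜 μ)}
    (hT : IsDunfordSchwartz T) {u : L1AddLinf 𝕜 μ} (hu : u.1 ∈ Lp 𝕜 2 μ)
    {ε : ℝ≥0∞} (hε : 0 < ε) :
    ∃ p g : L1AddLinf 𝕜 μ, T p = p ∧ g.1 ∈ Lp 𝕜 2 μ ∧
      ∫⁻ x, ‖(u - (p + (g - T g))).1 x‖ₑ ^ 2 ∂μ ≤ ε := by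
  let ι : Lp 𝕜 2 μ → L1AddLinf 𝕜 μ := fun v => ⟨v.1, mem_L1AddLinf_of_mem_L2 v.2⟩
  have hmem : ∀ v : Lp 𝕜 2 μ, (T (ι v)).1 ∈ Lp 𝕜 2 μ := fun v =>
    mem_L2_iff.2 ((hT.lintegral_sq_le (ι v)).trans_lt (mem_L2_iff.1 v.2))
  let L : Lp 𝕜 2 μ →ₗ[𝕜] Lp 𝕜 2 μ :=
    { toFun := fun v => ⟨(T (ι v)).1, hmem v⟩
      map_add' := fun v w => by
        have h := congrArg Subtype.val (map_add T (ι v) (ι w))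
        exact Subtype.ext h
      map_smul' := fun c v => by
        have h := congrArg Subtype.val (map_smul T c (ι v))
        exact Subtype.ext h }
  have hL : ∀ v, ‖L v‖ ≤ 1 * ‖v‖ := by
    intro v
    rw [one_mul, Lp.norm_def, Lp.norm_def]
    refine ENNReal.toReal_mono (Lp.eLpNorm_ne_top v) ?_
    have h := hT.lintegral_sq_le (ι v)
    rw [lintegral_enorm_sq, lintegral_enorm_sq] at h
    exact (ENNReal.pow_le_pow_left_iff two_ne_zero).1 h
  obtain ⟨δ, hδ0, hδ⟩ : ∃ δ : ℝ, 0 < δ ∧ ENNReal.ofReal δ ^ 2 ≤ ε := by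
    rcases eq_or_ne ε ∞ with rfl | h
    · exact ⟨1, one_pos, le_top⟩
    · refine ⟨√ε.toReal, Real.sqrt_pos.2 (ENNReal.toReal_pos hε.ne' h), ?_⟩
      rw [← ENNReal.ofReal_pow (Real.sqrt_nonneg _), Real.sq_sqrt ENNReal.toReal_nonneg,
        ENNReal.ofReal_toReal h]
  obtain ⟨p, g, hp, hd⟩ := exists_fixed_add_coboundary (L.mkContinuous 1 hL)
    (L.mkContinuous_norm_le zero_le_one hL) ⟨u.1, hu⟩ hδ0
  have hp' := congrArg Subtype.val hp
  refine ⟨ι p, ι g, Subtype.ext hp', g.2, ?_⟩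
  rw [lintegral_enorm_sq]
  refine le_trans (pow_le_pow_left₀ zero_le ?_ 2) hδ
  rw [Lp.norm_def] at hd
  have h := ENNReal.ofReal_le_ofReal hd.le
  rw [ENNReal.ofReal_toReal (Lp.eLpNorm_ne_top _)] at h
  exact h

/-! ### The Banach principle -/

/-- Outside a set of measure at most `ε` the averages of `f` stay within `a` of a Cauchy sequence,
so they eventually oscillate by at most `3 * a`. Letting `ε → 0` with `a` fixed makes the bad set
null; then `a` runs through `1 / (k + 1)`. -/
theorem averagesConverge_of_approx {T : Module.End 𝕜 (L1AddLinf 𝕜 μ)} {f : L1AddLinf 𝕜 μ}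
    (h : ∀ a : ℝ, 0 < a → ∀ ε : ℝ≥0∞, 0 < ε → ∃ c, AveragesConverge T c ∧
      μ {x | ∃ n : ℕ, n * a < ‖(orbitSum T n (f - c)).1 x‖} ≤ ε) :
    AveragesConverge T f := by
  have key : ∀ a : ℝ, 0 < a → ∀ᵐ x ∂μ, ∃ N : ℕ, ∀ m ≥ N, ∀ n ≥ N,
      dist ((m : 𝕜)⁻¹ * (orbitSum T m f).1 x) ((n : 𝕜)⁻¹ * (orbitSum T n f).1 x) ≤ 3 * a := by
    intro a ha
    rw [ae_iff]
    refine le_antisymm (le_of_forall_pos_le_add fun ε hε => ?_) zero_le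
    rw [zero_add]
    obtain ⟨c, hc, hε⟩ := h a ha ε hε
    refine le_trans (measure_mono_ae ?_) hε
    filter_upwards [hc, ae_all_iff.2 fun n : ℕ =>
      L1AddLinf.coeFn_sub (orbitSum T n f) (orbitSum T n c)] with x ⟨l, hl⟩ hx hbad
    by_contra hgood
    have hgood' : ∀ n : ℕ, ‖(orbitSum T n (f - c)).1 x‖ ≤ n * a := fun n =>
      not_lt.1 fun hn => hgood ⟨n, hn⟩
    have hclose : ∀ n : ℕ, dist ((n : 𝕜)⁻¹ * (orbitSum T n f).1 x)
        ((n : 𝕜)⁻¹ * (orbitSum T n c).1 x) ≤ a := by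
      intro n
      rw [dist_eq_norm, ← mul_sub, ← hx n, ← orbitSum_sub, norm_mul, norm_inv,
        RCLike.norm_natCast]
      rcases Nat.eq_zero_or_pos n with rfl | hn
      · simpa using ha.le
      · rw [inv_mul_le_iff₀ (by exact_mod_cast hn)]
        exact hgood' n
    obtain ⟨N, hN⟩ := Metric.cauchySeq_iff.1 hl.cauchySeq a ha
    refine hbad ⟨N, fun m hm n hn => ?_⟩
    have h1 := hclose m
    have h2 := hclose n
    have h3 := (hN m hm n hn).le
    rw [dist_comm] at h2
    linarith [dist_triangle4 ((m : 𝕜)⁻¹ * (orbitSum T m f).1 x)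
      ((m : 𝕜)⁻¹ * (orbitSum T m c).1 x) ((n : 𝕜)⁻¹ * (orbitSum T n c).1 x)
      ((n : 𝕜)⁻¹ * (orbitSum T n f).1 x)]
  have hall := ae_all_iff.2 fun k : ℕ => key (1 / ((k : ℝ) + 1)) (by positivity)
  filter_upwards [hall] with x hx
  refine cauchySeq_tendsto_of_complete (Metric.cauchySeq_iff.2 fun ε hε => ?_)
  obtain ⟨k, hk⟩ := exists_nat_one_div_lt (show 0 < ε / 3 by positivity)
  obtain ⟨N, hN⟩ := hx k
  exact ⟨N, fun m hm n hn => (hN m hm n hn).trans_lt (by linarith)⟩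

theorem IsDunfordSchwartz.averagesConverge_of_mem_L2 {T : Module.End 𝕜 (L1AddLinf 𝕜 μ)}
    (hT : IsDunfordSchwartz T) {f : L1AddLinf 𝕜 μ} (hf : f.1 ∈ Lp 𝕜 2 μ) :
    AveragesConverge T f := by
  refine averagesConverge_of_approx fun a ha ε hε => ?_
  have hb : 0 < ENNReal.ofReal (a / 2) := ENNReal.ofReal_pos.2 (by positivity)
  -- One factor `a / 2` pays for the maximal inequality, the other for bounding the excess by the
  -- square.
  obtain ⟨p, g, hp, hg, hle⟩ := hT.exists_L2_decomposition hf
    (ENNReal.mul_pos hb.ne' (ENNReal.mul_pos hb.ne' hε.ne').ne')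
  refine ⟨p + (g - T g), (averagesConverge_of_fixed hp).add (hT.averagesConverge_coboundary hg), ?_⟩
  have h1 := hT.maximal (f - (p + (g - T g))) (half_pos ha)
  rw [mul_div_cancel₀ a two_ne_zero] at h1
  have h2 := lintegral_ofReal_norm_sub_le_sq (f - (p + (g - T g))).1 (half_pos ha).le
  have h3 := (mul_le_mul_right h1 (ENNReal.ofReal (a / 2))).trans (h2.trans hle)
  rwa [ENNReal.mul_le_mul_iff_right hb.ne' ENNReal.ofReal_ne_top,
    ENNReal.mul_le_mul_iff_right hb.ne' ENNReal.ofReal_ne_top] at h3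

/-! ### Characterization of R_μ and approximation by L² -/

theorem measure_enorm_gt_lt_top_of_tendsto_rearrangement {f : Ω →ₘ[μ] 𝕜}
    (hf : Tendsto (fun t : ℝ≥0 => rearrangement μ f t) atTop (𝓝 0)) {a : ℝ≥0∞} (ha : 0 < a) :
    μ {x | a < ‖f x‖ₑ} < ∞ := by
  obtain ⟨t, ht⟩ := (hf.eventually_lt_const ha).exists
  obtain ⟨b, hb, hba⟩ := sInf_lt_iff.1 ht
  exact (measure_mono fun x hx => hba.trans hx).trans_lt (hb.2.trans_lt ENNReal.coe_lt_top)

theorem tendsto_rearrangement_of_measure_lt_top {f : Ω →ₘ[μ] 𝕜}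
    (hf : ∀ a : ℝ≥0∞, 0 < a → μ {x | a < ‖f x‖ₑ} < ∞) :
    Tendsto (fun t : ℝ≥0 => rearrangement μ f t) atTop (𝓝 0) := by
  refine ENNReal.tendsto_nhds_zero.2 fun a ha => ?_
  filter_upwards [eventually_ge_atTop (μ {x | a < ‖f x‖ₑ}).toNNReal] with t ht
  refine sInf_le ⟨ha, ?_⟩
  rw [← ENNReal.coe_toNNReal (hf a ha).ne]
  exact ENNReal.coe_le_coe.2 ht

/-- A class of functions lies in `R_μ` if and only if, for every `a > 0`, the part of its modulus
above the level `a` is integrable. -/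
theorem mem_RMu_iff {f : Ω →ₘ[μ] 𝕜} :
    f ∈ RMu 𝕜 μ ↔ ∀ a : ℝ, 0 < a → ∫⁻ x, ENNReal.ofReal (‖f x‖ - a) ∂μ < ∞ := by
  constructor
  · rintro ⟨hf, ht⟩ a ha
    obtain ⟨g, hg, h, hh, rfl⟩ := Submodule.mem_sup.1 hf
    have hh' : eLpNormEssSup h μ < ∞ := by
      rw [← eLpNorm_exponent_top]
      exact Lp.mem_Lp_iff_eLpNorm_lt_top.1 hh
    have hA := measure_enorm_gt_lt_top_of_tendsto_rearrangement ht (ENNReal.ofReal_pos.2 ha)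
    set A := {x | ENNReal.ofReal a < ‖(g + h : Ω →ₘ[μ] 𝕜) x‖ₑ}
    -- The excess lives on `A`, which has finite measure, so the bounded summand is integrable
    -- there.
    calc ∫⁻ x, ENNReal.ofReal (‖(g + h : Ω →ₘ[μ] 𝕜) x‖ - a) ∂μ
        ≤ ∫⁻ x, ‖g x‖ₑ + A.indicator (fun _ => eLpNormEssSup h μ) x ∂μ := by
          refine lintegral_mono_ae ?_
          filter_upwards [AEEqFun.coeFn_add g h, enorm_ae_le_eLpNormEssSup h μ] with x h1 h2
          by_cases hx : x ∈ A
          · rw [Set.indicator_of_mem hx]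
            calc ENNReal.ofReal (‖(g + h : Ω →ₘ[μ] 𝕜) x‖ - a)
                ≤ ENNReal.ofReal ‖(g + h : Ω →ₘ[μ] 𝕜) x‖ :=
                  ENNReal.ofReal_le_ofReal (by linarith)
              _ = ‖g x + h x‖ₑ := by rw [ofReal_norm, h1, Pi.add_apply]
              _ ≤ ‖g x‖ₑ + ‖h x‖ₑ := enorm_add_le _ _
              _ ≤ _ := by gcongr
          · have h3 : ‖(g + h : Ω →ₘ[μ] 𝕜) x‖ₑ ≤ ENNReal.ofReal a := not_lt.1 hx
            rw [← ofReal_norm, ENNReal.ofReal_le_ofReal_iff ha.le] at h3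
            rw [ENNReal.ofReal_of_nonpos (by linarith)]
            exact zero_le
      _ ≤ ∫⁻ x, ‖g x‖ₑ ∂μ + eLpNormEssSup h μ * μ A := by
          rw [lintegral_add_left' g.aestronglyMeasurable.enorm]
          exact add_le_add le_rfl (lintegral_indicator_const_le _ _)
      _ < ∞ := ENNReal.add_lt_top.2 ⟨mem_L1_iff.1 hg, ENNReal.mul_lt_top hh' hA⟩
  · intro hf
    constructor
    · obtain ⟨q, hq, -, hd⟩ := exists_truncation_const f zero_le_one
      rw [← sub_add_cancel f q]
      refine add_mem (mem_L1AddLinf_of_mem_L1 (mem_L1_iff.2 ?_))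
        (mem_L1AddLinf_of_mem_Linf (mem_Linf_of_ae_bound hq))
      rw [lintegral_congr_ae hd]
      exact hf 1 one_pos
    · refine tendsto_rearrangement_of_measure_lt_top fun b hb => ?_
      rcases eq_or_ne b ∞ with rfl | hb'
      · simp
      -- Half the level: above `2 * a` the excess over `a` is at least `a`, so Markov's inequality
      -- applies.
      obtain ⟨a, ha, rfl⟩ : ∃ a : ℝ, 0 < a ∧ ENNReal.ofReal (2 * a) = b :=
        ⟨b.toReal / 2, half_pos (ENNReal.toReal_pos hb.ne' hb'), by
          rw [mul_div_cancel₀ _ two_ne_zero, ENNReal.ofReal_toReal hb']⟩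
      have hm : AEMeasurable (fun x => ENNReal.ofReal (‖f x‖ - a)) μ :=
        (f.aestronglyMeasurable.norm.aemeasurable.sub_const _).ennreal_ofReal
      have h1 := mul_meas_ge_le_lintegral₀ hm (ENNReal.ofReal a)
      have h2 : μ {x | ENNReal.ofReal a ≤ ENNReal.ofReal (‖f x‖ - a)} < ∞ := by
        by_contra h3
        rw [not_lt_top_iff.1 h3, ENNReal.mul_top (ENNReal.ofReal_pos.2 ha).ne'] at h1
        exact (hf a ha).not_ge h1
      refine (measure_mono fun x hx => ?_).trans_lt h2
      have hx' : ENNReal.ofReal (2 * a) < ‖f x‖ₑ := hx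
      rw [← ofReal_norm, ENNReal.ofReal_lt_ofReal_iff_of_nonneg (by positivity)] at hx'
      exact ENNReal.ofReal_le_ofReal (by linarith)

theorem tendsto_lintegral_ofReal_norm_sub {p : Ω →ₘ[μ] 𝕜} (hp : p ∈ Lp 𝕜 1 μ) :
    Tendsto (fun N : ℕ => ∫⁻ x, ENNReal.ofReal (‖p x‖ - N) ∂μ) atTop (𝓝 0) := by
  have h := tendsto_lintegral_of_dominated_convergence' (μ := μ)
    (F := fun (N : ℕ) x => ENNReal.ofReal (‖p x‖ - N)) (f := fun _ => 0) (fun x => ‖p x‖ₑ)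
    (fun N => (p.aestronglyMeasurable.norm.aemeasurable.sub_const _).ennreal_ofReal)
    (fun N => Eventually.of_forall fun x => by
      exact (ENNReal.ofReal_le_ofReal (sub_le_self _ N.cast_nonneg)).trans (ofReal_norm _).le)
    (mem_L1_iff.1 hp).ne
    (Eventually.of_forall fun x => by
      refine tendsto_const_nhds.congr' ?_
      obtain ⟨M, hM⟩ := exists_nat_ge ‖p x‖
      filter_upwards [eventually_ge_atTop M] with N hN
      have : (M : ℝ) ≤ N := by exact_mod_cast hN
      exact (ENNReal.ofReal_of_nonpos (by linarith)).symm)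
  simpa using h

theorem mem_L2_of_mem_L1_of_bound {q : Ω →ₘ[μ] 𝕜} {N : ℝ} (hq : q ∈ Lp 𝕜 1 μ)
    (hN : ∀ᵐ x ∂μ, ‖q x‖ ≤ N) : q ∈ Lp 𝕜 2 μ := by
  rw [mem_L2_iff]
  calc ∫⁻ x, ‖q x‖ₑ ^ 2 ∂μ ≤ ∫⁻ x, ENNReal.ofReal N * ‖q x‖ₑ ∂μ := by
        refine lintegral_mono_ae ?_
        filter_upwards [hN] with x hx
        rw [sq]
        refine mul_le_mul_left ?_ _
        rw [← ofReal_norm]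
        exact ENNReal.ofReal_le_ofReal hx
    _ = ENNReal.ofReal N * ∫⁻ x, ‖q x‖ₑ ∂μ := lintegral_const_mul' _ _ ENNReal.ofReal_ne_top
    _ < ∞ := ENNReal.mul_lt_top ENNReal.ofReal_lt_top (mem_L1_iff.1 hq)

/-- Elements of `R_μ` are approximated by elements of `L²`, up to an arbitrarily small error above
a given level. -/
theorem exists_L2_approx {f : L1AddLinf 𝕜 μ} (hf : f.1 ∈ RMu 𝕜 μ) {a : ℝ} (ha : 0 < a)
    {ε : ℝ≥0∞} (hε : 0 < ε) :
    ∃ c : L1AddLinf 𝕜 μ, c.1 ∈ Lp 𝕜 2 μ ∧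
      ∫⁻ x, ENNReal.ofReal (‖(f - c).1 x‖ - a) ∂μ ≤ ε := by
  obtain ⟨q, hq, -, hd⟩ := L1AddLinf.exists_truncation_const f ha.le
  have hp1 : (f - q).1 ∈ Lp 𝕜 1 μ := by
    rw [mem_L1_iff, lintegral_congr_ae hd]
    exact mem_RMu_iff.1 hf a ha
  obtain ⟨N, hN⟩ :=
    ((tendsto_lintegral_ofReal_norm_sub hp1).eventually_le_const hε).exists
  -- `c` is integrable and bounded, hence in L². What it misses is `q`, of modulus at most `a`, and
  -- the small excess of `f - q` over `N`.
  obtain ⟨c, hcN, hcp, hcd⟩ := L1AddLinf.exists_truncation_const (f - q) (Nat.cast_nonneg N)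
  refine ⟨c, mem_L2_of_mem_L1_of_bound (mem_L1_of_le hp1 hcp) hcN, le_trans ?_ hN⟩
  rw [← lintegral_congr_ae hcd]
  refine lintegral_mono_ae ?_
  filter_upwards [hq, L1AddLinf.coeFn_sub (f - q) c, L1AddLinf.coeFn_sub f q,
    L1AddLinf.coeFn_sub f c] with x h1 h2 h3 h4
  rw [← ofReal_norm]
  refine ENNReal.ofReal_le_ofReal ?_
  rw [h2, h3, h4]
  have h5 : f.1 x - c.1 x = (f.1 x - q.1 x - c.1 x) + q.1 x := by ring
  rw [h5]
  linarith [norm_add_le (f.1 x - q.1 x - c.1 x) (q.1 x)]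

/-! ### The ergodic theorem in R_μ -/

namespace IsDunfordSchwartz

variable {T : Module.End 𝕜 (L1AddLinf 𝕜 μ)}

theorem averagesConverge (hT : IsDunfordSchwartz T) {f : L1AddLinf 𝕜 μ}
    (hf : f.1 ∈ RMu 𝕜 μ) : AveragesConverge T f := by
  refine averagesConverge_of_approx fun a ha ε hε => ?_
  have hb : 0 < ENNReal.ofReal (a / 2) := ENNReal.ofReal_pos.2 (by positivity)
  obtain ⟨c, hc, hle⟩ := exists_L2_approx hf (half_pos ha) (ENNReal.mul_pos hb.ne' hε.ne')
  refine ⟨c, hT.averagesConverge_of_mem_L2 hc, ?_⟩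
  have h1 := (hT.maximal (f - c) (half_pos ha)).trans hle
  rwa [mul_div_cancel₀ a two_ne_zero,
    ENNReal.mul_le_mul_iff_right hb.ne' ENNReal.ofReal_ne_top] at h1

/-- The excess of a sum over the sum of the levels is at most the sum of the excesses, and `T` does
not increase the integral of an excess. -/
theorem lintegral_ofReal_norm_orbitSum_sub_le (hT : IsDunfordSchwartz T) (f : L1AddLinf 𝕜 μ)
    {a : ℝ} (ha : 0 ≤ a) (n : ℕ) :
    ∫⁻ x, ENNReal.ofReal (‖(orbitSum T n f).1 x‖ - n * a) ∂μ
      ≤ n * ∫⁻ x, ENNReal.ofReal (‖f.1 x‖ - a) ∂μ := by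
  induction n with
  | zero =>
    have h : ∫⁻ x, ENNReal.ofReal (‖(orbitSum T 0 f).1 x‖ - (0 : ℕ) * a) ∂μ = ∫⁻ _, 0 ∂μ := by
      refine lintegral_congr_ae ?_
      filter_upwards [L1AddLinf.coeFn_zero (𝕜 := 𝕜) (μ := μ)] with x hx
      rw [orbitSum_zero, hx]
      simp
    rw [h]
    simp
  | succ n ih =>
    have hm : AEMeasurable (fun x => ENNReal.ofReal (‖f.1 x‖ - a)) μ :=
      (f.1.aestronglyMeasurable.norm.aemeasurable.sub_const _).ennreal_ofReal
    calc ∫⁻ x, ENNReal.ofReal (‖(orbitSum T (n + 1) f).1 x‖ - (n + 1 : ℕ) * a) ∂μ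
        ≤ ∫⁻ x, ENNReal.ofReal (‖f.1 x‖ - a)
            + ENNReal.ofReal (‖(T (orbitSum T n f)).1 x‖ - n * a) ∂μ := by
          refine lintegral_mono_ae ?_
          filter_upwards [L1AddLinf.coeFn_add f (T (orbitSum T n f))] with x hx
          rw [orbitSum_succ, hx]
          refine (ENNReal.ofReal_le_ofReal ?_).trans ENNReal.ofReal_add_le
          push_cast
          linarith [norm_add_le (f.1 x) ((T (orbitSum T n f)).1 x)]
      _ = ∫⁻ x, ENNReal.ofReal (‖f.1 x‖ - a) ∂μ
            + ∫⁻ x, ENNReal.ofReal (‖(T (orbitSum T n f)).1 x‖ - n * a) ∂μ :=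
          lintegral_add_left' hm _
      _ ≤ ∫⁻ x, ENNReal.ofReal (‖f.1 x‖ - a) ∂μ
            + n * ∫⁻ x, ENNReal.ofReal (‖f.1 x‖ - a) ∂μ :=
          add_le_add le_rfl
            ((hT.lintegral_ofReal_norm_sub_le _ (by positivity)).trans ih)
      _ = _ := by
          push_cast
          ring

theorem lintegral_ofReal_norm_average_sub_le (hT : IsDunfordSchwartz T) (f : L1AddLinf 𝕜 μ)
    {a : ℝ} (ha : 0 ≤ a) {n : ℕ} (hn : 0 < n) :
    ∫⁻ x, ENNReal.ofReal (‖(n : 𝕜)⁻¹ * (orbitSum T n f).1 x‖ - a) ∂μ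
      ≤ ∫⁻ x, ENNReal.ofReal (‖f.1 x‖ - a) ∂μ := by
  have hn' : (0 : ℝ) < n := by exact_mod_cast hn
  have hn0 : (n : ℝ≥0∞) ≠ 0 := by exact_mod_cast hn.ne'
  refine (ENNReal.mul_le_mul_iff_right hn0 (ENNReal.natCast_ne_top n)).1 (le_trans (le_of_eq ?_)
    (hT.lintegral_ofReal_norm_orbitSum_sub_le f ha n))
  rw [← lintegral_const_mul' _ _ (ENNReal.natCast_ne_top n)]
  refine lintegral_congr fun x => ?_
  rw [← ENNReal.ofReal_natCast, ← ENNReal.ofReal_mul hn'.le, norm_mul, norm_inv,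
    RCLike.norm_natCast, mul_sub, mul_inv_cancel_left₀ hn'.ne']

/-- The pointwise ergodic theorem in `R_μ`. -/
theorem averagesConvergeInRMu (hT : IsDunfordSchwartz T) {f : L1AddLinf 𝕜 μ}
    (hf : f.1 ∈ RMu 𝕜 μ) : AveragesConvergeInRMu T f := by
  have hmeas : ∀ n : ℕ, AEStronglyMeasurable
      (fun x => (n : 𝕜)⁻¹ * (orbitSum T n f).1 x) μ := fun n =>
    (AEEqFun.aestronglyMeasurable _).const_mul _
  obtain ⟨F, hF, hlim⟩ :=
    exists_stronglyMeasurable_limit_of_tendsto_ae hmeas (hT.averagesConverge hf)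
  refine ⟨AEEqFun.mk F hF.aestronglyMeasurable, mem_RMu_iff.2 fun a ha => ?_, ?_⟩
  · refine lt_of_le_of_lt ?_ (mem_RMu_iff.1 hf a ha)
    calc ∫⁻ x, ENNReal.ofReal (‖AEEqFun.mk F hF.aestronglyMeasurable x‖ - a) ∂μ
        = ∫⁻ x, liminf (fun n : ℕ =>
            ENNReal.ofReal (‖(n : 𝕜)⁻¹ * (orbitSum T n f).1 x‖ - a)) atTop ∂μ := by
          refine lintegral_congr_ae ?_
          filter_upwards [hlim, AEEqFun.coeFn_mk F hF.aestronglyMeasurable] with x hx h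
          rw [h]
          exact (((ENNReal.continuous_ofReal.tendsto _).comp
            (hx.norm.sub_const a)).liminf_eq).symm
      -- Fatou's lemma; the averages with `n > 0` have excess integrals bounded by that of `f`.
      _ ≤ liminf (fun n : ℕ => ∫⁻ x,
            ENNReal.ofReal (‖(n : 𝕜)⁻¹ * (orbitSum T n f).1 x‖ - a) ∂μ) atTop :=
          lintegral_liminf_le' fun n =>
            ((hmeas n).norm.aemeasurable.sub_const _).ennreal_ofReal
      _ ≤ _ := liminf_le_of_frequently_le' <| Eventually.frequently <| by
          filter_upwards [eventually_gt_atTop 0] with n hn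
          exact hT.lintegral_ofReal_norm_average_sub_le f ha.le hn
  · filter_upwards [hlim, AEEqFun.coeFn_mk F hF.aestronglyMeasurable,
      ae_all_iff.2 fun n => coeFn_ergodicAverage T n f] with x hx h1 h2
    rw [h1]
    exact hx.congr fun n => (h2 n).symm

end IsDunfordSchwartz

end

theorem theoremt3 {Ω : Type*} [MeasurableSpace Ω] (μ : Measure Ω) :
    (∀ T : Module.End ℝ (L1AddLinf ℝ μ), IsDunfordSchwartz T →
      ∀ f : L1AddLinf ℝ μ, (f : Ω →ₘ[μ] ℝ) ∈ RMu ℝ μ → AveragesConvergeInRMu T f) ∧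
    (∀ T : Module.End ℂ (L1AddLinf ℂ μ), IsDunfordSchwartz T → IsPositiveOperator T →
      ∀ f : L1AddLinf ℂ μ, (f : Ω →ₘ[μ] ℂ) ∈ RMu ℂ μ → AveragesConvergeInRMu T f) :=
  ⟨fun _ hT _ hf => hT.averagesConvergeInRMu hf, fun _ hT _ _ hf => hT.averagesConvergeInRMu hf⟩
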